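/- Fix $k\in\mathbb N$. A ($k$-dimensional, nondeterministic) vector addition system with states, $k$-VASS, $V$ consists of a finite alphabet $\Sigma$, a finite set $Q$ of states, an initial configuration $c_0\in Q\times\mathbb N^k$, a finite set $F\subseteq Q\times\mathbb N^k$ of final configurations and a finite set $\delta\subseteq Q\times\Sigma\times\mathbb Z^k\times Q$ of transitions. A transition $(s,a,v,s')$ reads the letter $a$; it can be fired in a configuration $q(u)\in Q\times\mathbb N^k$ if and only if $q=s$ and $u+v\ge 0$ componentwise, and it then leads to the configuration $s'(u+v)$. A run is a finite sequence of transitions that can be fired one after another; it is accepting if it starts in $c_0$ and ends in a configuration $q(u)$ such that $u\ge u'$ componentwise for some $q(u')\in F$. The (coverability) language $L(V)\subseteq\Sigma^*$ is the set of words read by accepting runs. $V$ is unambiguous if every $w\in L(V)$ is read by exactly one accepting run. It is undecidable whether $L(A)\subseteq L(B)$ for a given unambiguous 2-VASS $A$ and a given nondeterministic 2-VASS $B$ over the same finite alphabet. That is, there is no algorithm which, on every input consisting of (finite descriptions of) an unambiguous 2-VASS $A$ and an arbitrary 2-VASS $B$ over the same finite alphabet, halts and answers correctly whether $L(A)\subseteq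 L(B)$; nothing is required of the algorithm on inputs in which $A$ is not unambiguous. -/

import Mathlib

/-- A transition `(src, letter, eff, tgt)` of a `k`-dimensional VASS: it leaves the state `src`,
reads `letter`, adds `eff` to the counters and enters the state `tgt`. -/
@[ext]
structure VASSTransition (k : ℕ) (α Q : Type) where
  src : Q
  letter : α
  eff : Fin k → ℤ
  tgt : Q

/-- A `k`-dimensional vector addition system with states (`k`-VASS) over the alphabet `α` with
set of states `Q`: an initial configuration, a finite set of final configurations and a finite
set of transitions. It is nondeterministic in general. -/
@[ext]
structure VASS (k : ℕ) (α Q : Type) where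
  init : Q × (Fin k → ℕ)
  final : Finset (Q × (Fin k → ℕ))
  trans : Finset (VASSTransition k α Q)

namespace VASS

variable {k : ℕ} {α Q : Type}

/-- Firing `t` in the configuration `c` is possible and leads to the configuration `d`.
Counters of configurations are natural numbers, so this includes that they stay non-negative. -/
def Fires (t : VASSTransition k α Q) (c d : Q × (Fin k → ℕ)) : Prop :=
  c.1 = t.src ∧ d.1 = t.tgt ∧ ∀ i, (d.2 i : ℤ) = (c.2 i : ℤ) + t.eff i

/-- `V.IsRun c ρ d`: the sequence `ρ` of transitions of `V` can be fired one after another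
from the configuration `c`, and leads to the configuration `d`. -/
def IsRun (V : VASS k α Q) :
    Q × (Fin k → ℕ) → List (VASSTransition k α Q) → Q × (Fin k → ℕ) → Prop
  | c, [], d => c = d
  | c, t :: ρ, d => t ∈ V.trans ∧ ∃ e, Fires t c e ∧ IsRun V e ρ d

/-- A configuration is accepting if it covers some final configuration. -/
def IsAccepting (V : VASS k α Q) (c : Q × (Fin k → ℕ)) : Prop :=
  ∃ f ∈ V.final, c.1 = f.1 ∧ ∀ i, f.2 i ≤ c.2 i

/-- `ρ` is an accepting run of `V` over the word `w`. -/
def IsAcceptingRunOver (V : VASS k α Q) (ρ : List (VASSTransition k α Q)) (w : List α) : Prop :=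
  ρ.map VASSTransition.letter = w ∧ ∃ c, V.IsRun V.init ρ c ∧ V.IsAccepting c

/-- The (coverability) language of `V`: all words read by accepting runs. -/
def language (V : VASS k α Q) : Language α :=
  {w | ∃ ρ, V.IsAcceptingRunOver ρ w}

/-- `V` is unambiguous: every word of its language has exactly one accepting run. -/
def Unambiguous (V : VASS k α Q) : Prop :=
  ∀ w ∈ V.language, ∃! ρ, V.IsAcceptingRunOver ρ w

/-- The finite data by which a `k`-VASS with states and letters numbered from `0` is handed to an
algorithm: the number of letters and the number of states, the initial configuration, a list of
the final configurations, and a list of the transitions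
`(source, letter, effect, target)`. -/
abbrev Code (k : ℕ) : Type :=
  (ℕ × ℕ) × (ℕ × (Fin k → ℕ)) × List (ℕ × (Fin k → ℕ)) × List (ℕ × ℕ × (Fin k → ℤ) × ℕ)

/-- `V.IsCode c`: the data `c` describes the VASS `V`. -/
structure IsCode {m n : ℕ} (V : VASS k (Fin m) (Fin n)) (c : Code k) : Prop where
  sizes : c.1 = (m, n)
  init : c.2.1 = ((V.init.1 : ℕ), V.init.2)
  final : ∀ x, x ∈ c.2.2.1 ↔ ∃ f ∈ V.final, x = ((f.1 : ℕ), f.2)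
  trans : ∀ x, x ∈ c.2.2.2 ↔
    ∃ t ∈ V.trans, x = ((t.src : ℕ), (t.letter : ℕ), t.eff, (t.tgt : ℕ))

end VASS

/-! The halting problem reduces to non-inclusion. A partial recursive function is computed by a
stack machine. Stacks become registers by writing them in base `Fintype.card Γ + 1`, and finitely
many registers become one of two counters by Gödel numbering, the other counter being scratch space.
No counter machine is ever written down: the relations realised by a regular language of counter
operations form a Kleene algebra containing increment, decrement and zero test, and each layer only
needs closure under the Kleene operations (`KleeneClosed.simulated`,
`RegisterClosed.simulated_goedel`, `RegisterClosed.exists_halts`). Hence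
`exists_regular_executes_iff_dom`: halting means that some word of a fixed regular language can be
executed honestly, with the input entering only through the initial counters.

A VASS cannot test for zero. So `A` follows a DFA for this language and skips the tests; being
deterministic, it is unambiguous. `B` guesses a test of a nonzero counter, which it can verify by
decrementing that counter. A word of `A` escapes `B` exactly when it is an honest execution, so
inclusion means non-halting (`VASS.language_ofDFA_le_cheats_iff`). -/

open Relation Function Turing

/-! ### Kleene algebras of relations and simulation through an encoding -/

/-- A class of binary relations on `T` closed under the operations of Kleene algebra. -/
structure KleeneClosed {T : Type*} (C : (T → T → Prop) → Prop) : Prop where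
  one : C fun a b => b = a
  zero : C fun _ _ => False
  comp {R S} : C R → C S → C (Comp R S)
  union {R S} : C R → C S → C fun a b => R a b ∨ S a b
  star {R} : C R → C (ReflTransGen R)

namespace KleeneClosed

variable {T : Type*} {C : (T → T → Prop) → Prop}

theorem congr {R S : T → T → Prop} (hR : C R) (h : ∀ a b, R a b ↔ S a b) : C S := by
  have : R = S := by ext a b; exact h a b
  exact this ▸ hR

theorem iUnion_finset (hC : KleeneClosed C) {κ : Type*} (s : Finset κ) {R : κ → T → T → Prop}
    (hR : ∀ i ∈ s, C (R i)) : C fun a b => ∃ i ∈ s, R i a b := by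
  classical
  induction s using Finset.induction_on with
  | empty => exact congr hC.zero (by simp)
  | insert i s _ ih =>
    refine congr (hC.union (hR i (by simp)) (ih fun j hj => hR j (by simp [hj]))) ?_
    simp

theorem iUnion (hC : KleeneClosed C) {κ : Type*} [Finite κ] {R : κ → T → T → Prop}
    (hR : ∀ i, C (R i)) : C fun a b => ∃ i, R i a b := by
  have := Fintype.ofFinite κ
  exact congr (hC.iUnion_finset Finset.univ fun i _ => hR i) (by simp)

/-- Composition of guarded functions. -/
theorem seq (hC : KleeneClosed C) {P Q : T → Prop} {f g : T → T}
    (h₁ : C fun a b => P a ∧ b = f a) (h₂ : C fun a b => Q a ∧ b = g a) :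
    C fun a b => (P a ∧ Q (f a)) ∧ b = g (f a) := by
  refine congr (hC.comp h₁ h₂) fun a b => ?_
  constructor
  · rintro ⟨_, ⟨hp, rfl⟩, hq, rfl⟩
    exact ⟨⟨hp, hq⟩, rfl⟩
  · rintro ⟨⟨hp, hq⟩, rfl⟩
    exact ⟨_, ⟨hp, rfl⟩, hq, rfl⟩

end KleeneClosed

/-- The relations on `U` which are simulated, through the encoding `φ`, by a relation of `C`. -/
def Simulated {T U : Type*} (φ : U → T) (C : (T → T → Prop) → Prop) (R : U → U → Prop) : Prop :=
  ∃ R₀, C R₀ ∧ ∀ a b, R₀ (φ a) b ↔ ∃ b', R a b' ∧ φ b' = b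

/-- The condition on `R₀` also says that it never leads from an encoded point outside the range of
`φ`; this invariant lets compositions and iterations be lifted step by step. -/
theorem KleeneClosed.simulated {T U : Type*} {C : (T → T → Prop) → Prop} (hC : KleeneClosed C)
    (φ : U → T) : KleeneClosed (Simulated φ C) where
  one := ⟨_, hC.one, fun a b => by simp [eq_comm]⟩
  zero := ⟨_, hC.zero, fun a b => by simp⟩
  comp := by
    rintro R S ⟨R₀, hR, hR'⟩ ⟨S₀, hS, hS'⟩
    refine ⟨_, hC.comp hR hS, fun a b => ?_⟩
    constructor
    · rintro ⟨c, hac, hcb⟩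
      obtain ⟨c', hc', rfl⟩ := (hR' _ _).1 hac
      obtain ⟨b', hb', rfl⟩ := (hS' _ _).1 hcb
      exact ⟨b', ⟨c', hc', hb'⟩, rfl⟩
    · rintro ⟨b', ⟨c', hc', hb'⟩, rfl⟩
      exact ⟨φ c', (hR' _ _).2 ⟨c', hc', rfl⟩, (hS' _ _).2 ⟨b', hb', rfl⟩⟩
  union := by
    rintro R S ⟨R₀, hR, hR'⟩ ⟨S₀, hS, hS'⟩
    refine ⟨_, hC.union hR hS, fun a b => ?_⟩
    rw [hR', hS', ← exists_or]
    simp only [or_and_right]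
  star := by
    rintro R ⟨R₀, hR, hR'⟩
    refine ⟨_, hC.star hR, fun a b => ?_⟩
    constructor
    · intro h
      induction h with
      | refl => exact ⟨a, .refl, rfl⟩
      | tail _ h ih =>
        obtain ⟨c, hc, rfl⟩ := ih
        obtain ⟨d, hd, rfl⟩ := (hR' _ _).1 h
        exact ⟨d, hc.tail hd, rfl⟩
    · rintro ⟨b', h, rfl⟩
      exact h.lift φ fun x y hxy => (hR' _ _).2 ⟨y, hxy, rfl⟩

theorem Simulated.guarded {T U : Type*} {C : (T → T → Prop) → Prop} {φ : U → T}
    {P : T → Prop} {f : T → T} {Q : U → Prop} {g : U → U} (h : C fun a b => P a ∧ b = f a)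
    (hPQ : ∀ a, P (φ a) ↔ Q a) (hfg : ∀ a, Q a → f (φ a) = φ (g a)) :
    Simulated φ C fun a b => Q a ∧ b = g a := by
  refine ⟨_, h, fun a b => ?_⟩
  rw [hPQ]
  constructor
  · rintro ⟨hQ, rfl⟩
    exact ⟨_, ⟨hQ, rfl⟩, (hfg a hQ).symm⟩
  · rintro ⟨_, ⟨hQ, rfl⟩, rfl⟩
    exact ⟨hQ, (hfg a hQ).symm⟩

/-! ### Register programs: transfer and scaling -/

/-- A Kleene closed class of relations between valuations of the registers `ι` which contains
the increments, the decrements and the zero tests of all registers. -/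
structure RegisterClosed {ι : Type*} [DecidableEq ι] (C : ((ι → ℕ) → (ι → ℕ) → Prop) → Prop) :
    Prop extends KleeneClosed C where
  inc (i : ι) : C fun s t => True ∧ t = update s i (s i + 1)
  dec (i : ι) : C fun s t => 0 < s i ∧ t = update s i (s i - 1)
  isZero (i : ι) : C fun s t => s i = 0 ∧ t = s

namespace RegisterClosed

variable {ι : Type*} [DecidableEq ι] {C : ((ι → ℕ) → (ι → ℕ) → Prop) → Prop}

theorem add (hC : RegisterClosed C) (i : ι) (n : ℕ) :
    C fun s t => True ∧ t = update s i (s i + n) := by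
  induction n with
  | zero => exact KleeneClosed.congr hC.one (by simp)
  | succ n ih =>
    refine KleeneClosed.congr (hC.seq ih (hC.inc i)) fun s t => ?_
    simp [add_assoc]

theorem sub (hC : RegisterClosed C) (i : ι) (n : ℕ) :
    C fun s t => n ≤ s i ∧ t = update s i (s i - n) := by
  induction n with
  | zero => exact KleeneClosed.congr hC.one (by simp)
  | succ n ih =>
    refine KleeneClosed.congr (hC.seq ih (hC.dec i)) fun s t => ?_
    simp only [update_self, update_idem, Nat.sub_sub]
    exact and_congr_left fun _ => by omega

/-- Move the contents of register `i` to register `j`, scaling it by `q / p`. -/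
theorem transfer (hC : RegisterClosed C) {i j : ι} (hij : i ≠ j) (p q : ℕ) :
    C fun s t => ∃ n, s i = n * p ∧ t = update (update s i 0) j (s j + n * q) := by
  have body := hC.seq (hC.sub i p) (hC.add j q)
  refine KleeneClosed.congr (hC.comp (hC.star body) (hC.isZero i)) fun s t => ?_
  -- The loop may stop after any number `n` of rounds; only the zero test that follows forces
  -- register `i` to be used up.
  have key : ∀ t, ReflTransGen (fun a b : ι → ℕ => (p ≤ a i ∧ True) ∧
      b = update (update a i (a i - p)) j (update a i (a i - p) j + q)) s t ↔
      ∃ n, n * p ≤ s i ∧ t = update (update s i (s i - n * p)) j (s j + n * q) := by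
    intro t
    constructor
    · intro h
      induction h with
      | refl => exact ⟨0, by simp⟩
      | tail _ h ih =>
        obtain ⟨n, hn, rfl⟩ := ih
        obtain ⟨⟨hp, -⟩, rfl⟩ := h
        simp only [ne_eq, hij, not_false_eq_true, update_of_ne, update_self] at hp ⊢
        refine ⟨n + 1, by rw [add_mul]; omega, ?_⟩
        ext k
        by_cases hj : k = j
        · subst hj; simp [hij.symm, add_mul, add_assoc]
        · by_cases hi : k = i
          · subst hi; simp [hij, add_mul, Nat.sub_sub]
          · simp [hi, hj]
    · rintro ⟨n, hn, rfl⟩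
      induction n with
      | zero => simpa using ReflTransGen.refl
      | succ n ih =>
        rw [add_mul, one_mul] at hn
        refine (ih (by omega)).tail ⟨⟨?_, trivial⟩, ?_⟩
        · simp [hij]; omega
        · ext k
          by_cases hj : k = j
          · subst hj; simp [hij.symm, add_mul, add_assoc]
          · by_cases hi : k = i
            · subst hi; simp [hij, add_mul, Nat.sub_sub]
            · simp [hi, hj]
  constructor
  · rintro ⟨u, hu, h0, rfl⟩
    obtain ⟨n, hn, rfl⟩ := (key _).1 hu
    simp only [ne_eq, hij, not_false_eq_true, update_of_ne, update_self] at h0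
    exact ⟨n, by omega, by rw [h0]⟩
  · rintro ⟨n, hn, rfl⟩
    exact ⟨_, (key _).2 ⟨n, hn.ge, by simp [hn]⟩, by simp [hij], rfl⟩

/-- Multiply the contents of register `i` by `q / p`, using the auxiliary register `j`. -/
theorem scale (hC : RegisterClosed C) {i j : ι} (hij : i ≠ j) {p : ℕ} (hp : 0 < p) (q : ℕ) :
    C fun s t => (s j = 0 ∧ p ∣ s i) ∧ t = update s i (s i / p * q) := by
  -- Divisibility is not tested separately: if `p` does not divide the contents, subtracting `p`
  -- never reaches zero and the first transfer has no outcome.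
  refine KleeneClosed.congr (hC.comp (hC.isZero j)
    (hC.comp (hC.transfer hij p q) (hC.transfer hij.symm 1 1))) fun s t => ?_
  constructor
  · rintro ⟨_, ⟨h0, rfl⟩, _, ⟨n, hn, rfl⟩, m, hm, rfl⟩
    simp only [update_self, h0, zero_add, mul_one] at hm
    subst hm
    refine ⟨⟨h0, by simp [hn]⟩, ?_⟩
    ext k
    by_cases hj : k = j
    · subst hj; simp [hij.symm, h0]
    · by_cases hi : k = i
      · subst hi; simp [hij, hn, hp]
      · simp [hi, hj]
  · rintro ⟨⟨h0, n, hn⟩, rfl⟩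
    refine ⟨s, ⟨h0, rfl⟩, _, ⟨n, by rw [hn, mul_comm], rfl⟩, n * q, by simp [h0], ?_⟩
    ext k
    by_cases hj : k = j
    · subst hj; simp [hij.symm, h0]
    · by_cases hi : k = i
      · subst hi; simp [hij, hn, hp]
      · simp [hi, hj]

end RegisterClosed

/-! ### Gödel numbering: two counters suffice -/

section Goedel

variable {ι : Type*} [Fintype ι]

/-- A prime number for each register. -/
noncomputable def registerPrime (i : ι) : ℕ := Nat.nth Nat.Prime (Fintype.equivFin ι i)

theorem prime_registerPrime (i : ι) : (registerPrime i).Prime :=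
  Nat.prime_nth_prime _

theorem registerPrime_injective : Injective (registerPrime (ι := ι)) := fun _ _ h =>
  (Fintype.equivFin ι).injective
    (Fin.ext ((Nat.nth_injective Nat.infinite_setOfPred_prime) h))

/-- The Gödel number of a valuation of finitely many registers. -/
noncomputable def goedel (s : ι → ℕ) : ℕ := ∏ i, registerPrime i ^ s i

variable [DecidableEq ι]

theorem goedel_update (s : ι → ℕ) (i : ι) (n : ℕ) :
    goedel (update s i n) = registerPrime i ^ n * goedel (update s i 0) := by
  simp only [goedel]
  rw [← Finset.mul_prod_erase _ _ (Finset.mem_univ i),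
    ← Finset.mul_prod_erase Finset.univ (fun k => registerPrime k ^ update s i 0 k)
      (Finset.mem_univ i)]
  simp only [update_self, pow_zero, one_mul]
  congr 1
  refine Finset.prod_congr rfl fun k hk => ?_
  simp [Finset.ne_of_mem_erase hk]

theorem goedel_update_succ (s : ι → ℕ) (i : ι) :
    goedel (update s i (s i + 1)) = goedel s * registerPrime i := by
  rw [goedel_update, pow_succ, mul_right_comm, ← goedel_update, update_eq_self]

theorem goedel_eq_mul (s : ι → ℕ) (i : ι) (h : 0 < s i) :
    goedel s = goedel (update s i (s i - 1)) * registerPrime i := by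
  have := goedel_update_succ (update s i (s i - 1)) i
  simp only [update_self, update_idem, Nat.sub_add_cancel h, update_eq_self] at this
  exact this

theorem registerPrime_dvd_goedel (s : ι → ℕ) (i : ι) :
    registerPrime i ∣ goedel s ↔ 0 < s i := by
  constructor
  · intro h
    obtain ⟨k, -, hk⟩ := ((prime_registerPrime i).prime.dvd_finsetProd_iff _).1 h
    have hki : i = k := registerPrime_injective
      ((Nat.prime_dvd_prime_iff_eq (prime_registerPrime i) (prime_registerPrime k)).1
        ((prime_registerPrime i).dvd_of_dvd_pow hk))
    subst hki
    by_contra h0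
    have : s i = 0 := by omega
    rw [this, pow_zero] at hk
    exact (prime_registerPrime i).one_lt.ne' (Nat.dvd_one.1 hk)
  · intro h
    rw [goedel_eq_mul s i h]
    exact dvd_mul_left _ _

/-- Two counters simulate any finite number of registers. -/
theorem RegisterClosed.simulated_goedel {C : ((Fin 2 → ℕ) → (Fin 2 → ℕ) → Prop) → Prop}
    (hC : RegisterClosed C) :
    RegisterClosed (Simulated (fun s : ι → ℕ => ![goedel s, 0]) C) where
  toKleeneClosed := hC.simulated _
  inc i := by
    refine Simulated.guarded (hC.scale (zero_ne_one) one_pos (registerPrime i)) (by simp) ?_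
    intro s _
    ext k
    fin_cases k <;> simp [goedel_update_succ]
  dec i := by
    refine Simulated.guarded (hC.scale (zero_ne_one) (prime_registerPrime i).pos 1)
      (fun s => by simp [registerPrime_dvd_goedel]) ?_
    intro s h
    have := goedel_eq_mul s i h
    ext k
    fin_cases k <;> simp [this, (prime_registerPrime i).pos]
  isZero i := by
    set p := registerPrime i with hp
    have hpos : 0 < p := (prime_registerPrime i).pos
    -- Subtracting `r`, dividing by `p`, multiplying by `p` and adding `r` restores the counter, so
    -- it is a pure test of the residue. A zero register means that `p` does not divide the Gödel
    -- number, which is the union of these tests over the nonzero residues `r`.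
    have key (r : ℕ) : C fun s t => (s 1 = 0 ∧ r ≤ s 0 ∧ p ∣ s 0 - r) ∧ t = s := by
      refine KleeneClosed.congr (hC.seq (hC.seq (hC.seq (hC.sub 0 r)
        (hC.scale zero_ne_one hpos 1)) (hC.scale zero_ne_one one_pos p)) (hC.add 0 r)) ?_
      intro s t
      have h : (r ≤ s 0 ∧ p ∣ s 0 - r) → (s 0 - r) / p * p + r = s 0 := by
        rintro ⟨h1, h2⟩
        rw [Nat.div_mul_cancel h2]; omega
      constructor
      · rintro ⟨⟨⟨⟨h1, h2, h3⟩, -⟩, -⟩, rfl⟩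
        simp only [update_self, ne_eq, one_ne_zero, not_false_eq_true, update_of_ne] at h2 h3
        refine ⟨⟨h2, h1, h3⟩, ?_⟩
        simp [h ⟨h1, h3⟩]
      · rintro ⟨⟨h1, h2, h3⟩, ht⟩
        refine ⟨⟨⟨⟨h2, by simpa using h1, by simpa using h3⟩, by simpa using h1⟩, trivial⟩, ?_⟩
        simp [h ⟨h2, h3⟩, ht]
    refine Simulated.guarded (P := fun s => ∃ r ∈ Finset.Ioo 0 p, s 1 = 0 ∧ r ≤ s 0 ∧ p ∣ s 0 - r)
      (f := id) (KleeneClosed.congr (hC.iUnion_finset (Finset.Ioo 0 p) fun r _ => key r) ?_) ?_ ?_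
    · intro s t
      simp only [id, ← and_assoc, ← exists_and_right]
    · intro s
      rw [← not_iff_not, ← Ne, ← Nat.pos_iff_ne_zero, ← registerPrime_dvd_goedel s i]
      simp only [Matrix.cons_val_one, Matrix.cons_val_zero, true_and, ← hp, Finset.mem_Ioo]
      constructor
      · intro h
        by_contra hd
        refine h ⟨goedel s % p, ⟨?_, Nat.mod_lt _ hpos⟩, Nat.mod_le _ _, Nat.dvd_sub_mod _⟩
        exact Nat.pos_of_ne_zero fun h0 => hd (Nat.dvd_of_mod_eq_zero h0)
      · rintro hd ⟨r, ⟨h0, hr⟩, hle, hdvd⟩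
        have := (Nat.dvd_sub_iff_right hle hd).1 hdvd
        exact absurd (Nat.le_of_dvd h0 this) (by omega)
    · intro s _; rfl

end Goedel


/-! ### Stack machines on registers -/

section Stacks

variable {K Γ : Type*} [Fintype Γ]

/-- The code of a letter as a nonzero digit. -/
noncomputable def digit (a : Γ) : ℕ := Fintype.equivFin Γ a + 1

theorem digit_injective : Injective (digit (Γ := Γ)) := fun _ _ h =>
  (Fintype.equivFin Γ).injective (Fin.ext (Nat.succ_injective h))

theorem digit_pos (a : Γ) : 0 < digit a := Nat.succ_pos _

theorem digit_lt (a : Γ) : digit a < Fintype.card Γ + 1 :=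
  Nat.succ_lt_succ (Fintype.equivFin Γ a).2

/-- The code of a stack as a number whose last digit is the top of the stack. -/
noncomputable def stackCode : List Γ → ℕ
  | [] => 0
  | a :: l => stackCode l * (Fintype.card Γ + 1) + digit a

theorem stackCode_eq_zero {l : List Γ} : stackCode l = 0 ↔ l.head? = none := by
  cases l with
  | nil => simp [stackCode]
  | cons a l => simpa [stackCode] using fun _ => (digit_pos a).ne'

/-- Digits lie strictly between 0 and the base, so the residue determines the top letter. The
inequality excludes the empty stack, where truncated subtraction would make the divisibility
vacuous. -/
theorem stackCode_top {l : List Γ} {a : Γ} :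
    digit a ≤ stackCode l ∧ Fintype.card Γ + 1 ∣ stackCode l - digit a ↔ l.head? = some a := by
  cases l with
  | nil => simpa [stackCode] using (digit_pos a).ne'
  | cons b l =>
    simp only [stackCode, List.head?_cons, Option.some.injEq]
    constructor
    · rintro ⟨hle, hd⟩
      have h := (Nat.modEq_iff_dvd' hle).2 hd
      refine (digit_injective ?_).symm
      have h' : digit a ≡ digit b [MOD Fintype.card Γ + 1] := by simpa [Nat.ModEq] using h
      exact h'.eq_of_lt_of_lt (digit_lt a) (digit_lt b)
    · rintro rfl
      simp

/-- The registers used for stacks indexed by `K` and a label. -/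
noncomputable def stackRegisters (x : ℕ × (K → List Γ)) : Option (Option K) → ℕ
  -- Scratch register for `RegisterClosed.scale`, which requires it to be zero.
  | none => 0
  | some none => x.1
  | some (some k) => stackCode (x.2 k)

variable [DecidableEq K]

theorem stackRegisters_label (x : ℕ × (K → List Γ)) (n : ℕ) :
    update (stackRegisters x) (some none) n = stackRegisters (n, x.2) := by
  ext (_ | _ | k) <;> simp [stackRegisters]

theorem stackRegisters_update (x : ℕ × (K → List Γ)) (k : K) (l : List Γ) {n : ℕ}
    (hn : n = stackCode l) :
    update (stackRegisters x) (some (some k)) n = stackRegisters (x.1, update x.2 k l) := by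
  ext (_ | _ | j)
  · simp [stackRegisters]
  · simp [stackRegisters]
  · by_cases h : j = k
    · subst h; simp [stackRegisters, hn]
    · simp [stackRegisters, h]

variable {C : ((Option (Option K) → ℕ) → (Option (Option K) → ℕ) → Prop) → Prop}

namespace RegisterClosed

/-- The label is stored only between machine steps. While a statement is executed the register holds
0 and the control is carried by the Kleene expression. -/
theorem setLabel (hC : RegisterClosed C) (n : ℕ) :
    Simulated (stackRegisters (Γ := Γ)) C fun x y => x.1 = 0 ∧ y = (n, x.2) := by
  refine Simulated.guarded (hC.seq (hC.isZero (some none)) (hC.add (some none) n)) ?_ ?_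
  · simp [stackRegisters]
  · intro x hx
    simp [stackRegisters_label, stackRegisters, hx]

theorem clearLabel (hC : RegisterClosed C) (n : ℕ) :
    Simulated (stackRegisters (Γ := Γ)) C fun x y => x.1 = n ∧ y = (0, x.2) := by
  refine Simulated.guarded (hC.seq (hC.sub (some none) n) (hC.isZero (some none))) ?_ ?_
  · intro x
    simp only [stackRegisters, update_self]
    omega
  · intro x hx
    simp [stackRegisters_label, stackRegisters, hx]

theorem push (hC : RegisterClosed C) (k : K) (a : Γ) :
    Simulated stackRegisters C fun x y => True ∧ y = (x.1, update x.2 k (a :: x.2 k)) := by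
  refine Simulated.guarded (hC.seq (hC.scale (i := some (some k)) (j := none) (by simp) one_pos
    (Fintype.card Γ + 1)) (hC.add (some (some k)) (digit a))) ?_ ?_
  · simp [stackRegisters]
  · intro x _
    simp only [update_idem]
    apply stackRegisters_update
    simp [stackRegisters, stackCode]

theorem popSome (hC : RegisterClosed C) (k : K) (a : Γ) :
    Simulated stackRegisters C fun x y =>
      (x.2 k).head? = some a ∧ y = (x.1, update x.2 k (x.2 k).tail) := by
  refine Simulated.guarded (hC.seq (hC.sub (some (some k)) (digit a))
    (hC.scale (i := some (some k)) (j := none) (p := Fintype.card Γ + 1) (by simp)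
      (Nat.succ_pos _) 1)) ?_ ?_
  · intro x
    rw [← stackCode_top]
    simp [stackRegisters]
  · intro x hx
    simp only [update_idem]
    apply stackRegisters_update
    obtain ⟨l, hl⟩ := List.head?_eq_some_iff.1 hx
    simp [stackRegisters, hl, stackCode]

theorem pop (hC : RegisterClosed C) (k : K) (o : Option Γ) :
    Simulated stackRegisters C fun x y =>
      (x.2 k).head? = o ∧ y = (x.1, update x.2 k (x.2 k).tail) := by
  cases o with
  | some a => exact hC.popSome k a
  | none =>
    refine Simulated.guarded (hC.isZero (some (some k))) ?_ ?_
    · intro x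
      rw [← stackCode_eq_zero]
      simp [stackRegisters]
    · intro x hx
      rw [List.head?_eq_none_iff] at hx
      rw [hx, List.tail_nil, ← hx, update_eq_self]

theorem peek (hC : RegisterClosed C) (k : K) (o : Option Γ) :
    Simulated stackRegisters C fun x y => (x.2 k).head? = o ∧ y = x := by
  cases o with
  | some a =>
    refine KleeneClosed.congr ((hC.simulated _).seq (hC.pop k (some a)) (hC.push k a))
      fun x y => ?_
    simp only [and_true]
    refine and_congr_right fun h => ?_
    obtain ⟨l, hl⟩ := List.head?_eq_some_iff.1 h
    simp only [update_self, update_idem]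
    rw [hl, List.tail_cons, ← hl, update_eq_self]
  | none =>
    refine KleeneClosed.congr (hC.pop k none) fun x y => and_congr_right fun h => ?_
    rw [List.head?_eq_none_iff] at h
    rw [h, List.tail_nil, ← h, update_eq_self]

end RegisterClosed

variable {Λ σ : Type*}

/-- The label code and the stacks of a configuration. -/
def cfgCode (code : Option Λ × σ → ℕ) (c : TM2.Cfg (fun _ : K => Γ) Λ σ) : ℕ × (K → List Γ) :=
  (code (c.l, c.var), c.stk)

/-- Induction on the statement, with the internal state `v` as a parameter rather than as data. What
is read from a stack is guessed by a finite union over `Option Γ`, and the guard of each branch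
verifies the guess. -/
theorem RegisterClosed.stepAux (hC : RegisterClosed C) (code : Option Λ × σ → ℕ)
    (q : TM2.Stmt (fun _ : K => Γ) Λ σ) (v : σ) :
    Simulated stackRegisters C fun x y =>
      x.1 = 0 ∧ y = cfgCode code (TM2.stepAux q v x.2) := by
  have hK := hC.toKleeneClosed.simulated (stackRegisters (K := K) (Γ := Γ))
  induction q generalizing v with
  | push k f q ih =>
    exact KleeneClosed.congr (hK.seq (hC.push k (f v)) (ih v)) fun x y => by simp
  | peek k f q ih =>
    exact KleeneClosed.congr (hK.iUnion fun o => hK.seq (hC.peek k o) (ih (f v o)))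
      fun x y => by simp
  | pop k f q ih =>
    exact KleeneClosed.congr (hK.iUnion fun o => hK.seq (hC.pop k o) (ih (f v o)))
      fun x y => by simp
  | load a q ih => exact ih (a v)
  | branch f q₁ q₂ ih₁ ih₂ =>
    cases h : f v
    · exact KleeneClosed.congr (ih₂ v) fun x y => by simp [h]
    · exact KleeneClosed.congr (ih₁ v) fun x y => by simp [h]
  | goto l => exact hC.setLabel (code (some (l v), v))
  | halt => exact hC.setLabel (code (none, v))

/-- Registers simulate the computations of a stack machine with finitely many labels. -/
theorem RegisterClosed.exists_halts [Fintype σ] (hC : RegisterClosed C) [Inhabited Λ] {S : Finset Λ}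
    {M : Λ → TM2.Stmt (fun _ : K => Γ) Λ σ} (hM : TM2.Supports M S) :
    ∃ code : Option Λ × σ → ℕ, ∃ R, C R ∧ ∀ c : TM2.Cfg (fun _ : K => Γ) Λ σ,
      c.l ∈ Finset.insertNone S →
        ((∃ t, R (stackRegisters (cfgCode code c)) t) ↔
          (StateTransition.eval (TM2.step M) c).Dom) := by
  classical
  let P : Finset (Option Λ × σ) := Finset.insertNone S ×ˢ Finset.univ
  let code : Option Λ × σ → ℕ := fun x => P.toList.idxOf x
  have hcode : ∀ x ∈ P, ∀ y, code x = code y ↔ x = y := fun x hx y => by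
    exact List.idxOf_inj (Finset.mem_toList.2 hx)
  -- The label code is injective only on `P`, so simulation is restricted to configurations with
  -- labels in `S`, which `hM` makes closed under steps.
  let D : Type _ := {c : TM2.Cfg (fun _ : K => Γ) Λ σ // c.l ∈ Finset.insertNone S}
  let κ : D → ℕ × (K → List Γ) := fun c => cfgCode code c.1
  have hmem : ∀ c : D, (c.1.l, c.1.var) ∈ P := fun c => by simpa [P] using c.2
  have hK := hC.toKleeneClosed.simulated (stackRegisters (K := K) (Γ := Γ))
  have hD := hK.simulated κ
  have hstep : Simulated κ (Simulated stackRegisters C)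
      fun c d : D => d.1 ∈ TM2.step M c.1 := by
    refine ⟨_, hK.iUnion_finset S fun l _ => hK.iUnion fun v : σ =>
      hK.seq (hC.clearLabel (code (some l, v))) (hC.stepAux code (M l) v), fun c y => ?_⟩
    constructor
    · rintro ⟨l, hl, v, ⟨hc, -⟩, rfl⟩
      have heq := (hcode _ (hmem c) _).1 hc
      obtain ⟨⟨l', v', stk⟩, hcl⟩ := c
      simp only [Prod.mk.injEq] at heq
      obtain ⟨rfl, rfl⟩ := heq
      have hs : TM2.stepAux (M l) v' stk ∈ TM2.step M ⟨some l, v', stk⟩ := rfl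
      exact ⟨⟨_, TM2.step_supports M hM hs hcl⟩, hs, rfl⟩
    · rintro ⟨d, hd, rfl⟩
      obtain ⟨⟨l', v', stk⟩, hcl⟩ := c
      obtain ⟨d, hdl⟩ := d
      cases l' with
      | none => simp at hd
      | some l =>
        simp only [TM2.step, Option.mem_def, Option.some.injEq] at hd
        subst hd
        exact ⟨l, by simpa using hcl, v', ⟨rfl, rfl⟩, rfl⟩
  -- This final test discards the computations that the star cuts off before halting.
  have hhalt : Simulated κ (Simulated stackRegisters C)
      fun c d : D => c.1.l = none ∧ d = c := by
    refine ⟨_, hK.iUnion fun v : σ => hK.seq (hC.clearLabel (code (none, v)))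
      (hC.setLabel (code (none, v))), fun c y => ?_⟩
    constructor
    · rintro ⟨v, ⟨hc, -⟩, rfl⟩
      have heq := (hcode _ (hmem c) _).1 hc
      simp only [Prod.mk.injEq] at heq
      refine ⟨c, ⟨heq.1, rfl⟩, ?_⟩
      simp [κ, cfgCode, heq]
    · rintro ⟨d, ⟨hc, rfl⟩, rfl⟩
      refine ⟨d.1.var, ⟨?_, rfl⟩, ?_⟩ <;> simp [κ, cfgCode, hc]
  obtain ⟨R₁, ⟨R, hR, hR₁⟩, hR₂⟩ := hD.comp (hD.star hstep) hhalt
  refine ⟨code, R, hR, fun c hc => ?_⟩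
  have hlift : ∀ d, StateTransition.Reaches (TM2.step M) c d ↔
      ∃ h, ReflTransGen (fun c d : D => d.1 ∈ TM2.step M c.1) ⟨c, hc⟩ ⟨d, h⟩ := by
    intro d
    constructor
    · intro h
      induction h with
      | refl => exact ⟨hc, .refl⟩
      | tail _ h ih =>
        obtain ⟨h', ih⟩ := ih
        exact ⟨TM2.step_supports M hM h h', ih.tail h⟩
    · rintro ⟨h, h'⟩
      exact ReflTransGen.lift (p := fun a b => b ∈ TM2.step M a) Subtype.val (fun _ _ h => h) _ _ h'
  have hnone : ∀ d : TM2.Cfg (fun _ : K => Γ) Λ σ, TM2.step M d = none ↔ d.l = none := by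
    rintro ⟨_ | l, v, stk⟩ <;> simp
  rw [Part.dom_iff_mem]
  simp only [StateTransition.mem_eval, hnone]
  constructor
  · rintro ⟨t, ht⟩
    obtain ⟨y, hy, -⟩ := (hR₁ _ _).1 ht
    obtain ⟨d, ⟨e, hce, he, -⟩, -⟩ := (hR₂ ⟨c, hc⟩ _).1 hy
    exact ⟨e.1, (hlift _).2 ⟨e.2, hce⟩, he⟩
  · rintro ⟨d, hd, hdn⟩
    obtain ⟨hd', hcd⟩ := (hlift d).1 hd
    exact ⟨_, (hR₁ _ _).2 ⟨_, (hR₂ ⟨c, hc⟩ _).2 ⟨_, ⟨_, hcd, hdn, rfl⟩, rfl⟩, rfl⟩⟩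

end Stacks


/-! ### Closure properties of regular languages -/

section Regular

variable {α : Type*}

/-- Each left quotient is the union of the members `A` of `F` with `P x A`. A finite `F` has
finitely many such unions, so Myhill–Nerode applies. -/
theorem Language.isRegular_of_append_mem_iff {L : Language α} {F : Set (Language α)}
    (hF : F.Finite) (P : List α → Language α → Prop)
    (h : ∀ x y, x ++ y ∈ L ↔ ∃ A ∈ F, P x A ∧ y ∈ A) : L.IsRegular := by
  refine .of_finite_range_leftQuotient ((hF.powerset.image
    fun T : Set (Language α) => ({y | ∃ A ∈ T, y ∈ A} : Language α)).subset ?_)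
  rintro _ ⟨x, rfl⟩
  refine ⟨{A ∈ F | P x A}, fun A hA => hA.1, ?_⟩
  ext y
  refine Iff.trans ?_ (h x y).symm
  exact ⟨fun ⟨A, ⟨h1, h2⟩, h3⟩ => ⟨A, h1, h2, h3⟩, fun ⟨A, h1, h2, h3⟩ => ⟨A, ⟨h1, h2⟩, h3⟩⟩

theorem Language.isRegular_zero : (0 : Language α).IsRegular :=
  isRegular_of_append_mem_iff Set.finite_empty (fun _ _ => True) (by simp)

theorem Language.isRegular_one : (1 : Language α).IsRegular :=
  isRegular_of_append_mem_iff (Set.finite_singleton 1) (fun x _ => x = []) (by simp [mem_one])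

theorem Language.isRegular_singleton (a : α) : ({[a]} : Language α).IsRegular := by
  refine isRegular_of_append_mem_iff (F := {{[a]}, 1}) (by simp)
    (fun x A => x = [] ∧ A = {[a]} ∨ x = [a] ∧ A = 1) fun x y => ?_
  have h (A : Language α) (w : List α) (hA : A = {w}) : y ∈ A ↔ y = w := by rw [hA]; rfl
  change x ++ y = [a] ↔ _
  rw [List.append_eq_singleton_iff]
  constructor
  · rintro (⟨rfl, rfl⟩ | ⟨rfl, rfl⟩)
    · exact ⟨{[a]}, by simp, by simp, rfl⟩
    · exact ⟨1, by simp, by simp, rfl⟩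
  · rintro ⟨A, -, (⟨rfl, rfl⟩ | ⟨rfl, rfl⟩), hy⟩
    · exact Or.inl ⟨rfl, hy⟩
    · exact Or.inr ⟨rfl, hy⟩

/-- The prefix `x` ends either inside the factor from `L` or inside the one from `M`. -/
theorem Language.IsRegular.mul {L M : Language α} (hL : L.IsRegular) (hM : M.IsRegular) :
    (L * M).IsRegular := by
  refine isRegular_of_append_mem_iff
    ((hL.finite_range_leftQuotient.image (· * M)).union hM.finite_range_leftQuotient)
    (fun x A => A = L.leftQuotient x * M ∨
      ∃ u v, x = u ++ v ∧ u ∈ L ∧ A = M.leftQuotient v) fun x y => ?_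
  constructor
  · rintro ⟨l, hl, m, hm, h⟩
    rcases List.append_eq_append_iff.1 h.symm with ⟨l', rfl, rfl⟩ | ⟨v, rfl, rfl⟩
    · exact ⟨_, Or.inl ⟨_, ⟨x, rfl⟩, rfl⟩, Or.inl rfl, l', hl, m, hm, rfl⟩
    · exact ⟨_, Or.inr ⟨v, rfl⟩, Or.inr ⟨l, v, rfl, hl, rfl⟩, hm⟩
  · rintro ⟨A, -, rfl | ⟨u, v, rfl, hu, rfl⟩, hy⟩
    · obtain ⟨l', hl', m, hm, rfl⟩ := hy
      exact ⟨x ++ l', hl', m, hm, by simp⟩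
    · exact ⟨u, hu, v ++ y, hy, by simp⟩

open scoped Computability in
-- The prefix `x` consists of complete factors followed by a prefix `v` of the factor that it cuts.
-- The extra member `L∗` of the family covers the case where no factor remains.
theorem Language.IsRegular.kstar {L : Language α} (hL : L.IsRegular) : (L∗).IsRegular := by
  have hmul {u v : List α} (hu : u ∈ L∗) (hv : v ∈ L∗) : u ++ v ∈ L∗ := by
    rw [← kstar_mul_kstar L]
    exact append_mem_mul hu hv
  refine isRegular_of_append_mem_iff
    ((hL.finite_range_leftQuotient.image (· * L∗)).insert (L∗))
    (fun x A => A = L∗ ∧ x ∈ L∗ ∨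
      ∃ u v, x = u ++ v ∧ u ∈ L∗ ∧ A = L.leftQuotient v * L∗) fun x y => ?_
  constructor
  · rintro ⟨ws, h, hws⟩
    induction ws generalizing x with
    | nil =>
      obtain ⟨rfl, rfl⟩ := List.append_eq_nil_iff.1 h
      exact ⟨L∗, Or.inl rfl, Or.inl ⟨rfl, nil_mem_kstar L⟩, nil_mem_kstar L⟩
    | cons w ws ih =>
      have hw : w ∈ L := hws w (by simp)
      have hws' : ∀ y ∈ ws, y ∈ L := fun y hy => hws y (by simp [hy])
      rw [List.flatten_cons] at h
      rcases List.append_eq_append_iff.1 h with ⟨y₁, rfl, rfl⟩ | ⟨x', rfl, h'⟩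
      · exact ⟨_, Or.inr ⟨_, ⟨x, rfl⟩, rfl⟩, Or.inr ⟨[], x, rfl, nil_mem_kstar L, rfl⟩,
          y₁, hw, _, ⟨ws, rfl, hws'⟩, rfl⟩
      · have hwk : w ∈ L∗ := ⟨[w], by simp, by simpa using hw⟩
        obtain ⟨A, hA, hP, hy⟩ := ih x' h'.symm hws'
        refine ⟨A, hA, ?_, hy⟩
        rcases hP with ⟨rfl, hx⟩ | ⟨u, v, rfl, hu, rfl⟩
        · exact Or.inl ⟨rfl, hmul hwk hx⟩
        · exact Or.inr ⟨w ++ u, v, by simp, hmul hwk hu, rfl⟩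
  · rintro ⟨A, -, ⟨rfl, hx⟩ | ⟨u, v, rfl, hu, rfl⟩, hy⟩
    · exact hmul hx hy
    · obtain ⟨y₁, hy₁, y₂, hy₂, rfl⟩ := hy
      have : v ++ y₁ ∈ L∗ := ⟨[v ++ y₁], by simp, by simpa using (mem_leftQuotient v y₁).1 hy₁⟩
      simpa using hmul hu (hmul this hy₂)

end Regular

/-! ### Relations given by regular languages of operations -/

section Executes

variable {α T : Type*}

/-- The word `w` is the sequence of labels of a path from `c` to `d`. -/
def Executes (step : α → T → T → Prop) : T → List α → T → Prop
  | c, [], d => d = c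
  | c, a :: w, d => ∃ e, step a c e ∧ Executes step e w d

theorem executes_append {step : α → T → T → Prop} {c d : T} {u v : List α} :
    Executes step c (u ++ v) d ↔ ∃ e, Executes step c u e ∧ Executes step e v d := by
  induction u generalizing c with
  | nil => simp [Executes]
  | cons a u ih =>
    simp only [List.cons_append, Executes, ih]
    constructor
    · rintro ⟨e, he, f, hf, hd⟩
      exact ⟨f, ⟨e, he, hf⟩, hd⟩
    · rintro ⟨f, ⟨e, he, hf⟩, hd⟩
      exact ⟨e, he, f, hf, hd⟩

/-- The relation `R` is given by the paths labelled by the words of a regular language. -/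
def IsRegularRel (step : α → T → T → Prop) (R : T → T → Prop) : Prop :=
  ∃ L : Language α, L.IsRegular ∧ ∀ c d, R c d ↔ ∃ w ∈ L, Executes step c w d

theorem isRegularRel_step (step : α → T → T → Prop) (a : α) : IsRegularRel step (step a) := by
  refine ⟨{[a]}, Language.isRegular_singleton a, fun c d => ?_⟩
  constructor
  · exact fun h => ⟨[a], rfl, d, h, rfl⟩
  · rintro ⟨_, rfl, e, h, rfl⟩
    exact h

open scoped Computability in
theorem kleeneClosed_isRegularRel (step : α → T → T → Prop) :
    KleeneClosed (IsRegularRel step) where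
  one := ⟨1, Language.isRegular_one, fun c d => by simp [Language.mem_one, Executes]⟩
  zero := ⟨0, Language.isRegular_zero, fun c d => by simp⟩
  comp := by
    rintro R S ⟨L, hL, hR⟩ ⟨M, hM, hS⟩
    refine ⟨L * M, hL.mul hM, fun c d => ?_⟩
    constructor
    · rintro ⟨e, hce, hed⟩
      obtain ⟨u, hu, hu'⟩ := (hR _ _).1 hce
      obtain ⟨v, hv, hv'⟩ := (hS _ _).1 hed
      exact ⟨u ++ v, Language.append_mem_mul hu hv, executes_append.2 ⟨e, hu', hv'⟩⟩
    · rintro ⟨_, ⟨u, hu, v, hv, rfl⟩, h⟩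
      obtain ⟨e, hu', hv'⟩ := executes_append.1 h
      exact ⟨e, (hR _ _).2 ⟨u, hu, hu'⟩, (hS _ _).2 ⟨v, hv, hv'⟩⟩
  union := by
    rintro R S ⟨L, hL, hR⟩ ⟨M, hM, hS⟩
    refine ⟨L + M, hL.add hM, fun c d => ?_⟩
    simp only [hR, hS, ← exists_or, Language.mem_add, or_and_right]
  star := by
    rintro R ⟨L, hL, hR⟩
    refine ⟨L∗, hL.kstar, fun c d => ?_⟩
    constructor
    · intro h
      induction h with
      | refl => exact ⟨[], Language.nil_mem_kstar L, rfl⟩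
      | tail _ h ih =>
        obtain ⟨_, ⟨ws, rfl, hws⟩, hu⟩ := ih
        obtain ⟨v, hv, hv'⟩ := (hR _ _).1 h
        refine ⟨_, ⟨ws ++ [v], rfl, ?_⟩, ?_⟩
        · simpa [or_imp, forall_and] using ⟨hws, hv⟩
        · rw [List.flatten_append, executes_append]
          exact ⟨_, hu, by simpa using hv'⟩
    · rintro ⟨_, ⟨ws, rfl, hws⟩, h⟩
      induction ws generalizing c with
      | nil => obtain rfl : d = c := h; exact .refl
      | cons w ws ih =>
        rw [List.flatten_cons, executes_append] at h
        obtain ⟨e, hw, hd⟩ := h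
        exact .head ((hR _ _).2 ⟨w, hws w (by simp), hw⟩)
          (ih e (fun y hy => hws y (by simp [hy])) hd)

end Executes

/-! ### Counter operations, with and without zero tests -/

/-- The operations of a machine with two counters: increment, decrement and test for zero. -/
inductive CounterOp
  | inc (i : Fin 2)
  | dec (i : Fin 2)
  | isZero (i : Fin 2)
  deriving DecidableEq, Fintype

namespace CounterOp

/-- The change of the counters by an operation. -/
def effect : CounterOp → Fin 2 → ℤ
  | inc i => Pi.single i 1
  | dec i => Pi.single i (-1)
  | isZero _ => 0

/-- The counters which an operation tests for zero. -/
def tested : CounterOp → Finset (Fin 2)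
  | isZero i => {i}
  | _ => ∅

end CounterOp

section CounterStep

variable {k : ℕ} {α : Type*}

/-- The counters change by the effect of a letter, ignoring zero tests. -/
def WeakStep (eff : α → Fin k → ℤ) (a : α) (c d : Fin k → ℕ) : Prop :=
  ∀ i, (d i : ℤ) = c i + eff a i

/-- The counters change by the effect of a letter, and its zero tests succeed. -/
def StrictStep (eff : α → Fin k → ℤ) (test : α → Finset (Fin k)) (a : α)
    (c d : Fin k → ℕ) : Prop :=
  WeakStep eff a c d ∧ ∀ i ∈ test a, c i = 0

theorem WeakStep.unique {eff : α → Fin k → ℤ} {a : α} {c d e : Fin k → ℕ}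
    (hd : WeakStep eff a c d) (he : WeakStep eff a c e) : d = e := by
  funext i
  have h₁ := hd i
  have h₂ := he i
  omega

theorem Executes.weaken {eff : α → Fin k → ℤ} {test : α → Finset (Fin k)} {w : List α}
    {c d : Fin k → ℕ} (h : Executes (StrictStep eff test) c w d) :
    Executes (WeakStep eff) c w d := by
  induction w generalizing c with
  | nil => exact h
  | cons a w ih =>
    obtain ⟨e, he, h⟩ := h
    exact ⟨e, he.1, ih h⟩

end CounterStep

/-- Each basic operation is a one-letter word. The alphabet is free up to `e`, because the VASS to
be described have letters in some `Fin m`. -/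
theorem registerClosed_counterOp {α : Type*} (e : CounterOp ≃ α) :
    RegisterClosed (IsRegularRel (StrictStep (fun a => (e.symm a).effect)
      (fun a => (e.symm a).tested))) where
  toKleeneClosed := kleeneClosed_isRegularRel _
  inc i := by
    refine KleeneClosed.congr (isRegularRel_step _ (e (.inc i))) fun s t => ?_
    simp only [StrictStep, WeakStep, Equiv.symm_apply_apply, CounterOp.effect, CounterOp.tested,
      Finset.notMem_empty, false_imp_iff, implies_true, and_true, true_and, funext_iff]
    refine forall_congr' fun j => ?_
    by_cases h : j = i
    · subst h; simp; omega
    · simp [h]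
  dec i := by
    refine KleeneClosed.congr (isRegularRel_step _ (e (.dec i))) fun s t => ?_
    simp only [StrictStep, WeakStep, Equiv.symm_apply_apply, CounterOp.effect, CounterOp.tested,
      Finset.notMem_empty, false_imp_iff, implies_true, and_true, funext_iff]
    constructor
    · intro h
      have hi := h i
      simp only [Pi.single_eq_same] at hi
      refine ⟨by omega, fun j => ?_⟩
      have hj := h j
      by_cases h : j = i
      · subst h; simp; omega
      · simpa [h] using hj
    · rintro ⟨hi, h⟩ j
      rw [h j]
      by_cases h : j = i
      · subst h; simp; omega
      · simp [h]
  isZero i := by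
    refine KleeneClosed.congr (isRegularRel_step _ (e (.isZero i))) fun s t => ?_
    simp [StrictStep, WeakStep, CounterOp.effect, CounterOp.tested, funext_iff, and_comm]

/-! ### The two VASS and the inclusion of their languages -/

namespace VASS

variable {k : ℕ} {α Q : Type}

open scoped Classical in
/-- The VASS which follows a deterministic finite automaton and executes its input as counter
operations, ignoring zero tests. -/
noncomputable def ofDFA [Fintype α] [Fintype Q] (M : DFA α Q) (eff : α → Fin k → ℤ)
    (c : Fin k → ℕ) : VASS k α Q where
  init := (M.start, c)
  -- Every vector covers 0, so acceptance depends on the state alone.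
  final := (Finset.univ.filter (· ∈ M.accept)).image fun q => (q, 0)
  trans := Finset.univ.image fun x : Q × α => ⟨x.1, x.2, eff x.2, M.step x.1 x.2⟩

section OfDFA

variable [Fintype α] [Fintype Q] {M : DFA α Q} {eff : α → Fin k → ℤ} {c₀ : Fin k → ℕ}

theorem mem_trans_ofDFA {t : VASSTransition k α Q} :
    t ∈ (ofDFA M eff c₀).trans ↔ t.eff = eff t.letter ∧ t.tgt = M.step t.src t.letter := by
  simp only [ofDFA, Finset.mem_image, Finset.mem_univ, true_and]
  constructor
  · rintro ⟨x, rfl⟩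
    exact ⟨rfl, rfl⟩
  · rintro ⟨h₁, h₂⟩
    exact ⟨(t.src, t.letter), by ext <;> simp [h₁, h₂]⟩

theorem isAccepting_ofDFA {x : Q × (Fin k → ℕ)} :
    (ofDFA M eff c₀).IsAccepting x ↔ x.1 ∈ M.accept := by
  simp [IsAccepting, ofDFA]

theorem executes_of_isRun_ofDFA {ρ : List (VASSTransition k α Q)} {x y : Q × (Fin k → ℕ)}
    (h : (ofDFA M eff c₀).IsRun x ρ y) :
    y.1 = M.evalFrom x.1 (ρ.map VASSTransition.letter) ∧
      Executes (WeakStep eff) x.2 (ρ.map VASSTransition.letter) y.2 := by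
  induction ρ generalizing x with
  | nil => obtain rfl : x = y := h; exact ⟨rfl, rfl⟩
  | cons t ρ ih =>
    obtain ⟨ht, e, ⟨h₁, h₂, h₃⟩, h⟩ := h
    obtain ⟨h₄, h₅⟩ := mem_trans_ofDFA.1 ht
    obtain ⟨hy, he⟩ := ih h
    refine ⟨?_, e.2, fun i => by rw [h₃, h₄], he⟩
    rw [hy, h₂, h₅, h₁]
    rfl

theorem exists_isRun_ofDFA {w : List α} {q : Q} {c d : Fin k → ℕ}
    (h : Executes (WeakStep eff) c w d) :
    ∃ ρ, ρ.map VASSTransition.letter = w ∧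
      (ofDFA M eff c₀).IsRun (q, c) ρ (M.evalFrom q w, d) := by
  induction w generalizing q c with
  | nil => obtain rfl : d = c := h; exact ⟨[], rfl, rfl⟩
  | cons a w ih =>
    obtain ⟨e, he, h⟩ := h
    obtain ⟨ρ, hρ, hr⟩ := ih (q := M.step q a) h
    exact ⟨⟨q, a, eff a, M.step q a⟩ :: ρ, by simp [hρ], mem_trans_ofDFA.2 ⟨rfl, rfl⟩,
      (M.step q a, e), ⟨rfl, rfl, he⟩, hr⟩

theorem mem_language_ofDFA {w : List α} :
    w ∈ (ofDFA M eff c₀).language ↔ w ∈ M.accepts ∧ ∃ d, Executes (WeakStep eff) c₀ w d := by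
  constructor
  · rintro ⟨ρ, rfl, y, hr, ha⟩
    obtain ⟨h₁, h₂⟩ := executes_of_isRun_ofDFA hr
    rw [isAccepting_ofDFA, h₁] at ha
    exact ⟨ha, _, h₂⟩
  · rintro ⟨hw, d, hd⟩
    obtain ⟨ρ, hρ, hr⟩ := exists_isRun_ofDFA (M := M) (c₀ := c₀) (q := M.start) hd
    exact ⟨ρ, hρ, _, hr, isAccepting_ofDFA.2 hw⟩

/-- The source and the letter determine the transition, hence also the next configuration. -/
theorem isRun_ofDFA_unique {ρ ρ' : List (VASSTransition k α Q)} {x y y' : Q × (Fin k → ℕ)}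
    (h : (ofDFA M eff c₀).IsRun x ρ y) (h' : (ofDFA M eff c₀).IsRun x ρ' y')
    (hρ : ρ.map VASSTransition.letter = ρ'.map VASSTransition.letter) : ρ = ρ' := by
  induction ρ generalizing x ρ' with
  | nil => exact (List.map_eq_nil_iff.1 hρ.symm).symm
  | cons t ρ ih =>
    cases ρ' with
    | nil => simp at hρ
    | cons t' ρ' =>
      simp only [List.map_cons, List.cons.injEq] at hρ
      obtain ⟨hl, hρ⟩ := hρ
      obtain ⟨ht, e, ⟨h₁, h₂, h₃⟩, h⟩ := h
      obtain ⟨ht', e', ⟨h₁', h₂', h₃'⟩, h'⟩ := h'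
      obtain ⟨h₄, h₅⟩ := mem_trans_ofDFA.1 ht
      obtain ⟨h₄', h₅'⟩ := mem_trans_ofDFA.1 ht'
      have hs : t.src = t'.src := h₁.symm.trans h₁'
      have htt : t = t' := VASSTransition.ext hs hl (by rw [h₄, h₄', hl])
        (by rw [h₅, h₅', hl, hs])
      subst htt
      have hee : e = e' := by
        refine Prod.ext (h₂.trans h₂'.symm) (funext fun i => ?_)
        have := h₃ i
        have := h₃' i
        omega
      subst hee
      rw [ih h h' hρ]

theorem unambiguous_ofDFA : (ofDFA M eff c₀).Unambiguous := by
  rintro w ⟨ρ, hρ⟩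
  refine ⟨ρ, hρ, fun ρ' hρ' => ?_⟩
  obtain ⟨hw, y, hy, -⟩ := hρ
  obtain ⟨hw', y', hy', -⟩ := hρ'
  exact isRun_ofDFA_unique hy' hy (hw'.trans hw.symm)

end OfDFA

open scoped Classical in
/-- The VASS which accepts the sequences of counter operations in which some test for zero of a
nonzero counter occurs. -/
noncomputable def cheats [Fintype α] (eff : α → Fin k → ℤ) (test : α → Finset (Fin k))
    (c : Fin k → ℕ) : VASS k α (Fin 2) where
  init := (0, c)
  final := {(1, 0)}
  trans := (Finset.univ.image fun a => ⟨0, a, eff a, 0⟩) ∪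
    (Finset.univ.image fun a => ⟨1, a, 0, 1⟩) ∪
    -- The decrement can fire only if the tested counter is positive, which is the cheat to be
    -- caught. The counters no longer matter afterwards, as state 1 reads every continuation with
    -- effect 0.
    Finset.univ.biUnion fun a => (test a).image fun i => ⟨0, a, -Pi.single i 1, 1⟩

section Cheats

variable [Fintype α] {eff : α → Fin k → ℤ} {test : α → Finset (Fin k)} {c₀ : Fin k → ℕ}

theorem mem_trans_cheats {t : VASSTransition k α (Fin 2)} :
    t ∈ (cheats eff test c₀).trans ↔ t = ⟨0, t.letter, eff t.letter, 0⟩ ∨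
      t = ⟨1, t.letter, 0, 1⟩ ∨ ∃ i ∈ test t.letter, t = ⟨0, t.letter, -Pi.single i 1, 1⟩ := by
  simp only [cheats, Finset.mem_union, Finset.mem_image, Finset.mem_univ, true_and,
    Finset.mem_biUnion, or_assoc]
  refine or_congr ⟨?_, fun h => ⟨_, h.symm⟩⟩ (or_congr ⟨?_, fun h => ⟨_, h.symm⟩⟩
    ⟨?_, fun ⟨i, hi, h⟩ => ⟨_, i, hi, h.symm⟩⟩)
  · rintro ⟨a, rfl⟩; rfl
  · rintro ⟨a, rfl⟩; rfl
  · rintro ⟨a, i, hi, rfl⟩; exact ⟨i, hi, rfl⟩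

theorem isAccepting_cheats {x : Fin 2 × (Fin k → ℕ)} :
    (cheats eff test c₀).IsAccepting x ↔ x.1 = 1 := by
  simp [IsAccepting, cheats]

theorem isRun_cheats_caught (w : List α) (c : Fin k → ℕ) :
    ∃ ρ, ρ.map VASSTransition.letter = w ∧ (cheats eff test c₀).IsRun (1, c) ρ (1, c) := by
  induction w with
  | nil => exact ⟨[], rfl, rfl⟩
  | cons a w ih =>
    obtain ⟨ρ, hρ, hr⟩ := ih
    exact ⟨⟨1, a, 0, 1⟩ :: ρ, by simp [hρ], mem_trans_cheats.2 (Or.inr (Or.inl rfl)),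
      (1, c), ⟨rfl, rfl, by simp⟩, hr⟩

/-- The run copies the weak execution up to the first failing zero test and catches it there. -/
theorem exists_isRun_cheats {w : List α} {c d : Fin k → ℕ}
    (h : Executes (WeakStep eff) c w d) (hn : ∀ d, ¬ Executes (StrictStep eff test) c w d) :
    ∃ ρ, ρ.map VASSTransition.letter = w ∧ ∃ d, (cheats eff test c₀).IsRun (0, c) ρ (1, d) := by
  induction w generalizing c with
  | nil => exact absurd h (hn d)
  | cons a w ih =>
    obtain ⟨e, he, h⟩ := h
    by_cases hc : ∀ i ∈ test a, c i = 0
    · obtain ⟨ρ, hρ, d', hr⟩ := ih h fun d' hd' => hn d' ⟨e, ⟨he, hc⟩, hd'⟩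
      exact ⟨⟨0, a, eff a, 0⟩ :: ρ, by simp [hρ], d', mem_trans_cheats.2 (Or.inl rfl),
        (0, e), ⟨rfl, rfl, he⟩, hr⟩
    · push Not at hc
      obtain ⟨i, hi, hci⟩ := hc
      obtain ⟨ρ, hρ, hr⟩ := isRun_cheats_caught (eff := eff) (test := test) (c₀ := c₀) w
        (update c i (c i - 1))
      refine ⟨⟨0, a, -Pi.single i 1, 1⟩ :: ρ, by simp [hρ], _,
        mem_trans_cheats.2 (Or.inr (Or.inr ⟨i, hi, rfl⟩)), _, ⟨rfl, rfl, fun j => ?_⟩, hr⟩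
      by_cases hj : j = i
      · subst hj; simp; omega
      · simp [hj]

/-- As long as the run stays in state 0 its counters agree with the honest execution, so a catching
transition would make a zero counter negative. -/
theorem not_isRun_cheats {ρ : List (VASSTransition k α (Fin 2))} {c d d' : Fin k → ℕ}
    (h : Executes (StrictStep eff test) c (ρ.map VASSTransition.letter) d) :
    ¬ (cheats eff test c₀).IsRun (0, c) ρ (1, d') := by
  induction ρ generalizing c with
  | nil => intro h; exact absurd (congrArg Prod.fst h) zero_ne_one
  | cons t ρ ih =>
    rintro ⟨ht, ⟨q, e⟩, ⟨h₁, h₂, h₃⟩, hr⟩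
    obtain ⟨e', ⟨he', hz⟩, h⟩ := h
    rcases mem_trans_cheats.1 ht with h₀ | h₀ | ⟨i, hi, h₀⟩
    · rw [h₀] at h₂ h₃
      obtain rfl : q = 0 := h₂
      obtain rfl : e = e' := WeakStep.unique h₃ he'
      exact ih h hr
    · rw [h₀] at h₁
      exact absurd h₁ zero_ne_one
    · rw [h₀] at h₃
      have := h₃ i
      simp only [hz i hi, Pi.neg_apply, Pi.single_eq_same] at this
      omega

end Cheats

theorem language_ofDFA_le_cheats_iff [Fintype α] [Fintype Q] {M : DFA α Q}
    {eff : α → Fin k → ℤ} {test : α → Finset (Fin k)} {c₀ : Fin k → ℕ} :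
    (ofDFA M eff c₀).language ≤ (cheats eff test c₀).language ↔
      ¬ ∃ w ∈ M.accepts, ∃ d, Executes (StrictStep eff test) c₀ w d := by
  constructor
  · rintro hle ⟨w, hw, d, hd⟩
    obtain ⟨ρ, rfl, ⟨q, e⟩, hr, ha⟩ := hle (mem_language_ofDFA.2 ⟨hw, d, hd.weaken⟩)
    obtain rfl : q = 1 := isAccepting_cheats.1 ha
    exact not_isRun_cheats hd hr
  · rintro hn w hw
    obtain ⟨hw, d, hd⟩ := mem_language_ofDFA.1 hw
    obtain ⟨ρ, hρ, e, hr⟩ := exists_isRun_cheats (c₀ := c₀) hd fun d hd => hn ⟨w, hw, d, hd⟩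
    exact ⟨ρ, hρ, _, hr, isAccepting_cheats.2 rfl⟩

end VASS


/-! ### Computability of the encoding of the input -/

namespace Turing.PartrecToTM2

instance : Fintype K' := ⟨{.main, .rev, .aux, .stack}, by intro k; cases k <;> simp⟩

theorem trNat_bit_true (n : ℕ) : trNat (Nat.bit true n) = Γ'.bit1 :: trNat n := by
  rw [trNat, trNat, ← Num.ofNat'_eq, ← Num.ofNat'_eq, Num.ofNat'_bit]
  cases Num.ofNat' n <;> rfl

theorem trNat_bit_false {n : ℕ} (hn : n ≠ 0) :
    trNat (Nat.bit false n) = Γ'.bit0 :: trNat n := by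
  rw [trNat, trNat, ← Num.ofNat'_eq, ← Num.ofNat'_eq, Num.ofNat'_bit]
  cases h : Num.ofNat' n with
  | zero =>
    rw [Num.ofNat'_eq] at h
    have := Num.to_of_nat n
    rw [h] at this
    exact absurd this.symm hn
  | pos m => rfl

/-- The digit by which the last binary digit of a number is represented. -/
noncomputable def bitDigit (n : ℕ) : ℕ := if n % 2 = 0 then digit Γ'.bit0 else digit Γ'.bit1

/-- The least significant bit is on top of the stack, so halving `n` removes the top letter. At `n =
0` only the terminator is left. -/
theorem stackCode_trList_singleton {n : ℕ} (hn : n ≠ 0) :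
    stackCode (trList [n]) =
      stackCode (trList [n / 2]) * (Fintype.card Γ' + 1) + bitDigit n := by
  rcases Nat.even_or_odd' n with ⟨m, rfl | rfl⟩
  · have hm : m ≠ 0 := by rintro rfl; simp at hn
    have := trNat_bit_false hm
    rw [Nat.bit_false_apply] at this
    simp [trList, this, stackCode, bitDigit]
  · have := trNat_bit_true m
    rw [Nat.bit_true_apply] at this
    have h : (2 * m + 1) / 2 = m := by omega
    have h' : (2 * m + 1) % 2 = 1 := by omega
    simp [trList, this, stackCode, bitDigit, h, h']

theorem primrec_stackCode_trList : Primrec fun n : ℕ => stackCode (trList [n]) := by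
  have hlen : Primrec fun p : Unit × List ℕ => p.2.length := Primrec.list_length.comp Primrec.snd
  have hbit : Primrec bitDigit :=
    Primrec.ite (Primrec.eq.comp (Primrec.nat_mod.comp Primrec.id (Primrec.const 2))
      (Primrec.const 0)) (Primrec.const _) (Primrec.const _)
  -- Course-of-values recursion: `l` lists the earlier values, so its length is the argument and
  -- entry `l.length / 2` is the value at the half.
  have hstep : Primrec₂ fun (_ : Unit) (l : List ℕ) =>
      if l.length = 0 then some (stackCode (trList [0]))
      else l[l.length / 2]?.map fun x => x * (Fintype.card Γ' + 1) + bitDigit l.length := by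
    refine Primrec.ite (Primrec.eq.comp hlen (Primrec.const 0)) (Primrec.const _) ?_
    refine Primrec.option_map (Primrec.list_getElem?.comp Primrec.snd
      (Primrec.nat_div.comp hlen (Primrec.const 2))) ?_
    exact Primrec.nat_add.comp (Primrec.nat_mul.comp Primrec.snd (Primrec.const _))
      (hbit.comp (hlen.comp Primrec.fst))
  refine (Primrec.nat_strong_rec (fun (_ : Unit) n => stackCode (trList [n])) hstep
    fun _ n => ?_).comp (Primrec.const ()) Primrec.id
  rcases eq_or_ne n 0 with rfl | hn
  · simp
  · have h : n / 2 < n := Nat.div_lt_self (Nat.pos_of_ne_zero hn) one_lt_two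
    rw [stackCode_trList_singleton hn]
    simp [hn, h]

end Turing.PartrecToTM2

theorem Primrec.const_pow (p : ℕ) : Primrec fun n : ℕ => p ^ n := by
  refine (Primrec.nat_rec₁ 1 (f := fun _ x => x * p)
    (Primrec.nat_mul.comp Primrec.snd (Primrec.const p))).of_eq fun n => ?_
  induction n with
  | zero => rfl
  | succ n ih => rw [pow_succ, ← ih]

open Turing.PartrecToTM2 in
/-- The halting problem of two counter machines: every domain of a partial recursive function is
reduced to the executions of the words of a regular language of counter operations. -/
theorem exists_regular_executes_iff_dom {f : ℕ →. ℕ} (hf : Partrec f) {α : Type*}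
    (e : CounterOp ≃ α) :
    ∃ (L : Language α) (g : ℕ → ℕ), L.IsRegular ∧ Primrec g ∧ ∀ n, (f n).Dom ↔
      ∃ w ∈ L, ∃ d, Executes (StrictStep (fun a => (e.symm a).effect)
        (fun a => (e.symm a).tested)) ![g n, 0] w d := by
  obtain ⟨c, hc⟩ := ToPartrec.Code.exists_code (Nat.Partrec'.part_iff₁.2 hf)
  -- `TM2.Supports` wants the default label in the support, so the default is the start label for
  -- `c`.
  let inst : Inhabited Λ' := ⟨trNormal c Cont'.halt⟩
  obtain ⟨code, R, ⟨R₀, ⟨L, hL, hLR⟩, hR₀⟩, hR⟩ :=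
    ((registerClosed_counterOp e).simulated_goedel
      (ι := Option (Option K'))).exists_halts (tr_supports c Cont'.halt)
  let x : ℕ → ℕ × (K' → List Γ') := fun n => cfgCode code (init c [n])
  have hx (n : ℕ) : stackRegisters (x n) =
      update (stackRegisters (x 0)) (some (some K'.main)) (stackCode (trList [n])) := by
    rw [stackRegisters_update _ _ _ rfl]
    simp only [x, cfgCode, init, K'.elim_update_main]
  refine ⟨L, fun n => goedel (stackRegisters (x n)), hL, ?_, fun n => ?_⟩
  -- Only the main stack depends on `n`, so the Gödel number is a fixed factor times a fixed prime
  -- to the power of the stack code.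
  · refine (Primrec.nat_mul.comp ((Primrec.const_pow (registerPrime (some (some K'.main)))).comp
      primrec_stackCode_trList) (Primrec.const
      (goedel (update (stackRegisters (x 0)) (some (some K'.main)) 0)))).of_eq fun n => ?_
    rw [hx n, goedel_update _ _ (stackCode _)]
  · have h₁ : (f n).Dom ↔ (StateTransition.eval (TM2.step tr) (init c [n])).Dom := by
      rw [tr_eval]
      have := hc ⟨[n], rfl⟩
      rw [show c.eval [n] = _ from this]
      rfl
    rw [h₁, ← hR (init c [n])
      (Finset.some_mem_insertNone.2 (codeSupp_self _ _ (trStmts₁_self _)))]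
    constructor
    · rintro ⟨t, ht⟩
      obtain ⟨w, hw, h⟩ := (hLR _ _).1 ((hR₀ _ _).2 ⟨t, ht, rfl⟩)
      exact ⟨w, hw, _, h⟩
    · rintro ⟨w, hw, d, h⟩
      obtain ⟨t, ht, -⟩ := (hR₀ _ _).1 ((hLR _ _).2 ⟨w, hw, h⟩)
      exact ⟨t, ht⟩

/-! ### Descriptions of VASS and the reduction -/

namespace VASS

variable {k m n : ℕ}

/-- A description of a VASS. -/
noncomputable def toCode (V : VASS k (Fin m) (Fin n)) : Code k :=
  ((m, n), ((V.init.1 : ℕ), V.init.2), V.final.toList.map fun f => ((f.1 : ℕ), f.2),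
    V.trans.toList.map fun t => ((t.src : ℕ), (t.letter : ℕ), t.eff, (t.tgt : ℕ)))

theorem isCode_toCode (V : VASS k (Fin m) (Fin n)) : V.IsCode V.toCode where
  sizes := rfl
  init := rfl
  final x := by simp [toCode, eq_comm]
  trans x := by simp [toCode, eq_comm]

/-- Descriptions depend computably on the initial values of the counters. -/
theorem computable_toCode {α : Type*} [Primcodable α] {V : α → VASS k (Fin m) (Fin n)}
    {q : Fin n} {F : Finset (Fin n × (Fin k → ℕ))} {δ : Finset (VASSTransition k (Fin m) (Fin n))}
    {c : α → Fin k → ℕ} (hc : Computable c) (hV : ∀ x, V x = ⟨(q, c x), F, δ⟩) :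
    Computable fun x => (V x).toCode := by
  simp only [hV, toCode]
  exact (Computable.const _).pair (((Computable.const _).pair hc).pair (Computable.const _))

end VASS

theorem Primrec.vecCons_zero {α : Type*} [Primcodable α] {g : α → ℕ} (hg : Primrec g) :
    Primrec fun x => (![g x, 0] : Fin 2 → ℕ) := by
  rw [Primrec.fin_curry]
  refine (Primrec.ite (Primrec.eq.comp Primrec.snd (Primrec.const (0 : Fin 2)))
    (hg.comp Primrec.fst) (Primrec.const 0)).of_eq ?_
  rintro ⟨x, i⟩
  fin_cases i <;> simp

/-- No algorithm (partial computable function) halts with the correct answer to the question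
whether `L(A) ⊆ L(B)` on all inputs that describe an unambiguous 2-VASS `A` and an arbitrary
(nondeterministic) 2-VASS `B` over the same finite alphabet. Nothing is required of the algorithm
on other inputs. -/
theorem corollary5 :
    ¬ ∃ decider : VASS.Code 2 × VASS.Code 2 →. Bool, Partrec decider ∧
      ∀ (m p q : ℕ) (A : VASS 2 (Fin m) (Fin p)) (B : VASS 2 (Fin m) (Fin q))
        (a b : VASS.Code 2), A.IsCode a → B.IsCode b → A.Unambiguous →
        ∃ answer ∈ decider (a, b), (answer = true ↔ A.language ≤ B.language) := by
  rintro ⟨decider, hdec, hspec⟩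
  have hf : Partrec fun n : ℕ => (Denumerable.ofNat Nat.Partrec.Code n).eval 0 :=
    Nat.Partrec.Code.eval_part.comp (Computable.ofNat _) (Computable.const 0)
  obtain ⟨L, g, ⟨Q, _, M', hM'⟩, hg, hL⟩ :=
    exists_regular_executes_iff_dom hf (Fintype.equivFin CounterOp)
  let M := DFA.reindex (Fintype.equivFin Q) M'
  have hM : M.accepts = L := (DFA.accepts_reindex _ _).trans hM'
  let eff (a : Fin (Fintype.card CounterOp)) := ((Fintype.equivFin CounterOp).symm a).effect
  let test (a : Fin (Fintype.card CounterOp)) := ((Fintype.equivFin CounterOp).symm a).tested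
  let c (x : Nat.Partrec.Code) : Fin 2 → ℕ := ![g (Encodable.encode x), 0]
  have hc : Computable c := (Primrec.vecCons_zero (hg.comp Primrec.encode)).to_comp
  let A (x : Nat.Partrec.Code) := VASS.ofDFA M eff (c x)
  let B (x : Nat.Partrec.Code) := VASS.cheats eff test (c x)
  -- States, transitions and final configurations are the same for all `x`; only the initial
  -- counters vary.
  have hcode : Computable fun x => ((A x).toCode, (B x).toCode) :=
    (VASS.computable_toCode hc fun _ => rfl).pair (VASS.computable_toCode hc fun _ => rfl)
  -- Every `A x` is unambiguous, so the partial decider halts on all these inputs and yields a total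
  -- computable function.
  choose answer hmem hiff using fun x => hspec _ _ _ (A x) (B x) _ _
    (VASS.isCode_toCode _) (VASS.isCode_toCode _) VASS.unambiguous_ofDFA
  have hanswer : Computable answer :=
    Partrec.of_eq (hdec.comp hcode) fun x => Part.eq_some_iff.2 (hmem x)
  have hhalt (x : Nat.Partrec.Code) : (x.eval 0).Dom ↔ ¬ (A x).language ≤ (B x).language := by
    rw [VASS.language_ofDFA_le_cheats_iff, not_not, hM]
    have := hL (Encodable.encode x)
    rwa [Denumerable.ofNat_encode] at this
  refine ComputablePred.halting_problem 0 (ComputablePred.computable_iff.2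
    ⟨fun x => !answer x, Primrec.not.to_comp.comp hanswer, funext fun x => propext ?_⟩)
  rw [hhalt, ← hiff]
  simp
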